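/- Let $X$ be a crowded Polish space, i.e. a non-empty separable completely metrizable space without isolated points. A relation on $X$ is a set $R\subseteq X^{n}$ for some $n=n_R$ with $1\le n<\omega$; it is meager if it is a meager subset of $X^{n}$. A set $F\subseteq X$ is $R$-free if no injective tuple $(x_0,\dots,x_{n_R-1})$ of elements of $F$ belongs to $R$. Let $\mathcal R$ be a countable (that is, $|\mathcal R|\le\omega$) collection of meager relations on $X$. Then there exists $F\subseteq X$ such that $F$ is dense in $X$, $F$ is a Baire space in the subspace topology (every non-empty open subset of $F$ is non-meager in $F$), and $F$ is $R$-free for every $R\in\mathcal R$. Furthermore, let $\mathsf{cof(meager)}$ be the minimal cardinality of a collection $\mathcal M$ of meager subsets of the Cantor space $2^\omega$ such that every meager subset of $2^\omega$ is contained in a member of $\mathcal M$, and let $\mathfrak c=2^{\aleph_0}$. Then for every cardinal $\kappa$ with $\mathsf{cof(meager)}\le\kappa\le\mathfrak c$ there exists such a set $F$ (dense in $X$, Baire, and $R$-free for every $R\in\mathcal R$) with $|F|=\kappa$. -/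

import Mathlib

open Cardinal

universe u

/-- A (finitary) relation on `X`: a subset of `X ^ n` for some `1 ≤ n < ω`. -/
structure FinitaryRel (X : Type u) where
  arity : ℕ
  one_le_arity : 1 ≤ arity
  carrier : Set (Fin arity → X)

namespace FinitaryRel

/-- A relation on a topological space is meager if it is a meager subset of the power `X ^ n`,
with the product topology. -/
def IsMeager {X : Type u} [TopologicalSpace X] (R : FinitaryRel X) : Prop :=
  IsMeagre R.carrier

/-- `F ⊆ X` is `R`-free if no injective tuple of elements of `F` lies in `R`. -/
def IsFree {X : Type u} (R : FinitaryRel X) (F : Set X) : Prop :=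
  ∀ x : Fin R.arity → X, Function.Injective x → (∀ i, x i ∈ F) → x ∉ R.carrier

end FinitaryRel

/-- `cof(meager)`: the minimal size of a family `M` of meager subsets of the Cantor space `2^ω`
such that every meager subset of `2^ω` is contained in a member of `M`. -/
noncomputable def cofMeager : Cardinal.{0} :=
  sInf {c : Cardinal.{0} | ∃ M : Set (Set (ℕ → Bool)),
    (∀ A ∈ M, IsMeagre A) ∧
    (∀ N : Set (ℕ → Bool), IsMeagre N → ∃ A ∈ M, N ⊆ A) ∧
    #M = c}

/-!
Write `2^ω` for the Cantor space `ℕ → Bool`. Everything is proved in `2^ω` and then carried over.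

The heart is `exists_free_family`, which produces all points of the free set at once rather than by
transfinite recursion. Cut `ℕ` into intervals ("blocks") and label the nodes of the binary tree so
that, on the `k`-th block, points carrying the labels of distinct nodes of height `k` are already
forced into the `k`-th dense open set of each of the first `k` relations
(`exists_generic_labels`). Following distinct branches then gives a family whose tuples are generic
on almost all blocks. Each point must also lie in a prescribed open set and outside a prescribed
meagre set, and for this it is overwritten on some blocks. Fix a nonprincipal ultrafilter `U` on the
set of blocks: overwriting on a set of blocks outside `U` is always enough
(`exists_small_modification`). Finitely many such sets do not cover a set in `U`, so every tuple
keeps its generic labels on infinitely many blocks, hence avoids all the relations.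

Index the points by a set of size `κ` that enumerates all pairs of a basic open set and a member of
a cofinal family of meagre sets of size `cof(meager)`; the resulting set is nonmeagre in every
nonempty open set, so it is dense and Baire (`baireSpace_of_forall_inter_not_subset`). The diagonal,
which is meagre as `X` is crowded, is added to the relations and makes the points distinct.

A Polish space `X` is reached through a map `2^ω → X` that behaves like a continuous open surjection
on a residual set (`exists_isCategoryCoding`), under which meagre relations pull back to meagre
relations (`IsCategoryCoding.isMeagre_preimage`). The existence of some free set, without a
prescribed size, is the case `κ = 𝔠`, as `cof(meager) ≤ 𝔠` (`cofMeager_le_continuum`).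
-/

open Set Filter Topology

/-! ### Meagre sets and dense open sets -/

/-- In a Baire space, a meagre set is avoided by the intersection of a decreasing sequence of dense
open sets; so it suffices to lie in infinitely many of them to be outside the meagre set. -/
theorem IsMeagre.exists_antitone_dense_open {Y : Type*} [TopologicalSpace Y] [BaireSpace Y]
    {M : Set Y} (hM : IsMeagre M) :
    ∃ G : ℕ → Set Y, Antitone G ∧ (∀ k, IsOpen (G k)) ∧ (∀ k, Dense (G k)) ∧
      ∀ y, (∀ j, ∃ k, j ≤ k ∧ y ∈ G k) → y ∉ M := by
  obtain ⟨t, htM, htG, htd⟩ := mem_residual.1 hM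
  obtain ⟨f, hf, rfl⟩ := isGδ_iff_eq_iInter_nat.1 htG
  refine ⟨fun k => ⋂ i ∈ Iic k, f i, ?_, ?_, ?_, ?_⟩
  · intro a b hab
    exact biInter_subset_biInter_left (Iic_subset_Iic.2 hab)
  · exact fun k => (finite_Iic k).isOpen_biInter fun i _ => hf i
  · exact fun k => htd.mono (subset_iInter₂ fun i _ => iInter_subset f i)
  · intro y hy
    refine htM (mem_iInter.2 fun j => ?_)
    obtain ⟨k, hjk, hk⟩ := hy j
    exact mem_iInter₂.1 hk j hjk

theorem isOpenMap_precomp_of_injective {ι κ Y : Type*} [TopologicalSpace Y] {τ : ι → κ}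
    (hτ : Function.Injective τ) : IsOpenMap fun y : κ → Y => y ∘ τ := by
  refine IsOpenMap.of_sections fun x => ⟨fun w => Function.extend τ w x, ?_, ?_, ?_⟩
  · refine Continuous.continuousAt (continuous_pi fun k => ?_)
    by_cases hk : ∃ i, τ i = k
    · obtain ⟨i, rfl⟩ := hk
      simpa [hτ.extend_apply] using continuous_apply i
    · simpa [Function.extend_apply' _ _ _ hk] using continuous_const
  · funext k
    by_cases hk : ∃ i, τ i = k
    · obtain ⟨i, rfl⟩ := hk
      simp [hτ.extend_apply]
    · simp [Function.extend_apply' _ _ _ hk]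
  · intro w
    funext i
    simp [hτ.extend_apply]

/-! ### Finite windows in finite powers of the Cantor space -/

theorem exists_prefix_subset_of_isOpen {S : Type*} [Finite S] {O : Set (S → ℕ → Bool)}
    (hO : IsOpen O) {z : S → ℕ → Bool} (hz : z ∈ O) :
    ∃ n, ∀ y : S → ℕ → Bool, (∀ s, ∀ p < n, y s p = z s p) → y ∈ O := by
  have := Fintype.ofFinite S
  obtain ⟨v, hv, hvO⟩ := isOpen_pi_iff'.1 hO z hz
  choose I w hw hwv using fun s => isOpen_pi_iff.1 (hv s).1 (z s) (hv s).2
  refine ⟨(Finset.univ.sup fun s => (I s).sup id) + 1,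
    fun y hy => hvO fun s _ => hwv s fun p hp => ?_⟩
  have hp' : p ≤ Finset.univ.sup fun s => (I s).sup id :=
    (Finset.le_sup (f := id) hp).trans
      (Finset.le_sup (f := fun s => (I s).sup id) (Finset.mem_univ s))
  rw [hy s p (by omega)]
  exact (hw s p hp).2

theorem exists_prefix_subset_of_isOpen_cantor {O : Set (ℕ → Bool)}
    (hO : IsOpen O) {z : ℕ → Bool} (hz : z ∈ O) :
    ∃ n, ∀ y : ℕ → Bool, (∀ p < n, y p = z p) → y ∈ O := by
  obtain ⟨n, hn⟩ := exists_prefix_subset_of_isOpen (S := Unit)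
    (hO.preimage (continuous_apply ())) (z := fun _ => z) hz
  exact ⟨n, fun y hy => hn (fun _ => y) fun _ => hy⟩

/-- Addition of `q` modulo 2, a self-homeomorphism of a power of the Cantor space. -/
def xorHomeomorph {S : Type*} (q : S → ℕ → Bool) : (S → ℕ → Bool) ≃ₜ (S → ℕ → Bool) where
  toFun y s p := xor (q s p) (y s p)
  invFun y s p := xor (q s p) (y s p)
  left_inv y := by funext s p; simp
  right_inv y := by funext s p; simp
  continuous_toFun := by
    refine continuous_pi fun s => continuous_pi fun p => ?_
    exact (continuous_of_discreteTopology (f := fun b => xor (q s p) b)).comp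
      ((continuous_apply p).comp (continuous_apply s))
  continuous_invFun := by
    refine continuous_pi fun s => continuous_pi fun p => ?_
    exact (continuous_of_discreteTopology (f := fun b => xor (q s p) b)).comp
      ((continuous_apply p).comp (continuous_apply s))

/-- Membership in a dense open subset of a finite power of the Cantor space can be forced by values
on a window `[m, m')` alone, whatever happens below `m`. The intersection of the finitely many
translates of the set by changes below `m` is still dense open, and any point of it yields the
values. -/
theorem Dense.exists_window {S : Type*} [Finite S] {D : Set (S → ℕ → Bool)} (hD : Dense D)
    (hDo : IsOpen D) (m : ℕ) :
    ∃ m', m < m' ∧ ∃ t : S → ℕ → Bool,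
      ∀ y : S → ℕ → Bool, (∀ s p, m ≤ p → p < m' → y s p = t s p) → y ∈ D := by
  let ext : (S → Fin m → Bool) → S → ℕ → Bool :=
    fun q s p => if h : p < m then q s ⟨p, h⟩ else false
  let D' : Set (S → ℕ → Bool) := ⋂ q : S → Fin m → Bool, xorHomeomorph (ext q) ⁻¹' D
  have hD'o : IsOpen D' :=
    isOpen_iInter_of_finite fun q => hDo.preimage (xorHomeomorph (ext q)).continuous
  have hD'd : Dense D' := dense_iInter_of_isOpen
    (fun q => hDo.preimage (xorHomeomorph (ext q)).continuous)
    (fun q => hD.preimage (xorHomeomorph (ext q)).isOpenMap)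
  obtain ⟨z, hz⟩ := hD'd.nonempty
  obtain ⟨n, hn⟩ := exists_prefix_subset_of_isOpen hD'o hz
  refine ⟨max n (m + 1), by omega, z, fun y hy => ?_⟩
  let q : S → Fin m → Bool := fun s p => xor (y s p) (z s p)
  have hyq : xorHomeomorph (ext q) y ∈ D' := by
    refine hn _ fun s p hp => ?_
    by_cases hpm : p < m
    · simp only [xorHomeomorph, ext, q, hpm, dif_pos, Homeomorph.homeomorph_mk_coe, Equiv.coe_fn_mk]
      cases y s p <;> cases z s p <;> rfl
    · simp [xorHomeomorph, ext, hpm, hy s p (by omega) (by omega)]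
  have := mem_iInter.1 hyq q
  rwa [mem_preimage, show xorHomeomorph (ext q) (xorHomeomorph (ext q) y) = y from
    (xorHomeomorph (ext q)).left_inv y] at this

theorem Dense.exists_window_cantor {D : Set (ℕ → Bool)} (hD : Dense D) (hDo : IsOpen D) (m : ℕ) :
    ∃ m', m < m' ∧ ∃ t : ℕ → Bool,
      ∀ y : ℕ → Bool, (∀ p, m ≤ p → p < m' → y p = t p) → y ∈ D := by
  have hc : Continuous fun y : Unit → ℕ → Bool => y () := continuous_apply ()
  have ho : IsOpenMap fun y : Unit → ℕ → Bool => y () := isOpenMap_eval ()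
  obtain ⟨m', hm', t, ht⟩ := (hD.preimage ho).exists_window (hDo.preimage hc) m
  exact ⟨m', hm', t (), fun y hy => ht (fun _ => y) fun _ => hy⟩

/-! ### Interval partitions -/

/-- A strictly increasing sequence starting at `0` cuts `ℕ` into intervals `[m k, m (k + 1))`; the
map `K` sends a number to the index of its interval. -/
theorem StrictMono.exists_blockIndex {m : ℕ → ℕ} (hm : StrictMono m) (h0 : m 0 = 0) :
    ∃ K : ℕ → ℕ, ∀ k p, m k ≤ p ↔ k ≤ K p := by
  refine ⟨fun p => Nat.findGreatest (fun k => m k ≤ p) p, fun k p => ⟨fun h => ?_, fun h => ?_⟩⟩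
  · exact Nat.le_findGreatest ((hm.id_le k).trans h) h
  · exact (hm.monotone h).trans
      (Nat.findGreatest_spec (P := fun k => m k ≤ p) (Nat.zero_le p) (by omega))

/-- Points prescribed on the successive intervals `[e j, e (j + 1))` can be glued together. -/
theorem StrictMono.exists_glue {α : Type*} {e : ℕ → ℕ} (he : StrictMono e) (v : ℕ → α)
    (T : ℕ → ℕ → α) :
    ∃ y : ℕ → α, (∀ p < e 0, y p = v p) ∧ ∀ j p, e j ≤ p → p < e (j + 1) → y p = T j p := by
  classical
  refine ⟨fun p => if h : ∃ j, e j ≤ p ∧ p < e (j + 1) then T h.choose p else v p, ?_, ?_⟩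
  · intro p hp
    refine dif_neg ?_
    rintro ⟨j, hj, -⟩
    have := he.monotone (Nat.zero_le j)
    omega
  · intro j p h1 h2
    have h : ∃ j, e j ≤ p ∧ p < e (j + 1) := ⟨j, h1, h2⟩
    have h3 := h.choose_spec
    have e1 : h.choose < j + 1 := he.lt_iff_lt.1 (h3.1.trans_lt h2)
    have e2 : j < h.choose + 1 := he.lt_iff_lt.1 (h1.trans_lt h3.2)
    have e3 : h.choose = j := by omega
    simp only [dif_pos h, e3]

/-! ### Escaping a meagre set by a small modification -/

/-- Given an interval partition with block index `K`, a nonprincipal ultrafilter `U`, a nonempty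
open set `V` and a meagre set `M` of the Cantor space, prescribing values on a `U`-small set `Z` of
blocks suffices to force a point into `V \ M`. Two disjoint choices of `Z`, up to finitely many
blocks, are available (even-numbered or odd-numbered stretches), and `U` rejects one of them. -/
theorem exists_small_modification {m K : ℕ → ℕ} (hm : StrictMono m)
    (hK : ∀ k p, m k ≤ p ↔ k ≤ K p) {U : Ultrafilter ℕ} (hU : (U : Filter ℕ) ≤ cofinite)
    {V M : Set (ℕ → Bool)} (hV : IsOpen V) (hVne : V.Nonempty) (hM : IsMeagre M) :
    ∃ (Z : Set ℕ) (y : ℕ → Bool), Z ∉ U ∧ ∀ z : ℕ → Bool, (∀ p, K p ∈ Z → z p = y p) →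
      z ∈ V \ M := by
  obtain ⟨G, hGa, hGo, hGd, hGM⟩ := hM.exists_antitone_dense_open
  obtain ⟨v, hv⟩ := hVne
  obtain ⟨n₀, hn₀⟩ := exists_prefix_subset_of_isOpen_cantor hV hv
  have step : ∀ j k : ℕ, ∃ k', k < k' ∧ ∃ t : ℕ → Bool,
      ∀ z : ℕ → Bool, (∀ p, m k ≤ p → p < m k' → z p = t p) → z ∈ G j := by
    intro j k
    obtain ⟨m', hm', t, ht⟩ := (hGd j).exists_window_cantor (hGo j) (m k)
    refine ⟨max m' (k + 1), by omega, t, fun z hz => ht z fun p h1 h2 => hz p h1 ?_⟩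
    exact h2.trans_le ((le_max_left _ _).trans (hm.id_le _))
  choose next hnext t ht using step
  let e : ℕ → ℕ := fun j => Nat.rec n₀ (fun j k => next j k) j
  have hes : ∀ j, e (j + 1) = next j (e j) := fun j => rfl
  have he : StrictMono e := strictMono_nat_of_lt_succ fun j => by rw [hes]; exact hnext _ _
  obtain ⟨y, hy0, hy⟩ := (hm.comp he).exists_glue v fun j => t j (e j)
  -- the stretches of one parity, together with the initial stretch that places `z` in `V`
  let W : Bool → Set ℕ := fun b => Iio n₀ ∪ ⋃ j, ⋃ (_ : j.bodd = b), Ico (e j) (e (j + 1))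
  have hW : ∃ b, W b ∉ U := by
    by_contra! h
    have h1 : W true ∩ W false ∈ U := inter_mem (h true) (h false)
    have h2 : W true ∩ W false ⊆ Iio n₀ := by
      rintro k ⟨hk1 | hk1, hk2 | hk2⟩
      · exact hk1
      · exact hk1
      · exact hk2
      · simp only [mem_iUnion] at hk1 hk2
        obtain ⟨i, hi, hki⟩ := hk1
        obtain ⟨j, hj, hkj⟩ := hk2
        have e1 : i < j + 1 := he.lt_iff_lt.1 (hki.1.trans_lt hkj.2)
        have e2 : j < i + 1 := he.lt_iff_lt.1 (hkj.1.trans_lt hki.2)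
        have e3 : i = j := by omega
        subst e3
        rw [hi] at hj
        exact absurd hj (by decide)
    have h3 : (Iio n₀)ᶜ ∈ U := hU (finite_Iio n₀).compl_mem_cofinite
    have h4 := inter_mem (mem_of_superset h1 h2) h3
    rw [inter_compl_self] at h4
    exact U.empty_notMem h4
  obtain ⟨b, hb⟩ := hW
  refine ⟨W b, y, hb, fun z hz => ⟨?_, ?_⟩⟩
  · refine hn₀ z fun p hp => ?_
    have hpm : p < m n₀ := hp.trans_le (hm.id_le n₀)
    have hKp : K p < n₀ := not_le.1 fun h => absurd ((hK _ _).2 h) (not_le.2 hpm)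
    rw [hz p (Or.inl hKp)]
    exact hy0 p hpm
  · refine hGM z fun i => ?_
    obtain ⟨j, hij, hjb⟩ : ∃ j, i ≤ j ∧ j.bodd = b := by
      by_cases hib : i.bodd = b
      · exact ⟨i, le_rfl, hib⟩
      · refine ⟨i + 1, by omega, ?_⟩
        rw [Nat.bodd_succ]
        cases h : i.bodd <;> cases b <;> simp_all
    refine ⟨j, hij, ht j (e j) z fun p h1 h2 => ?_⟩
    have hKp : K p ∈ Ico (e j) (e (j + 1)) :=
      ⟨(hK _ _).1 h1, not_le.1 fun h => absurd ((hK _ _).2 h) (not_le.2 h2)⟩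
    rw [hz p (Or.inr (mem_iUnion₂.2 ⟨j, hjb, hKp⟩))]
    exact hy j p h1 h2

/-! ### A generic tree and the free family in the Cantor space -/

/-- Levels `m k` and labels `t k σ` of the nodes `σ` of height `k` of the binary tree such that
points carrying the labels of distinct nodes on the `k`-th block lie in the `k`-th dense open set
of each of the first `k` relations. -/
theorem exists_generic_labels (n : ℕ → ℕ) (G : ∀ i : ℕ, ℕ → Set (Fin (n i) → ℕ → Bool))
    (hGo : ∀ i k, IsOpen (G i k)) (hGd : ∀ i k, Dense (G i k)) :
    ∃ (m : ℕ → ℕ) (t : ∀ k, (Fin k → Bool) → ℕ → Bool), StrictMono m ∧ m 0 = 0 ∧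
      ∀ k, ∀ i < k, ∀ τ : Fin (n i) → Fin k → Bool, Function.Injective τ →
        ∀ x : Fin (n i) → ℕ → Bool,
          (∀ l p, m k ≤ p → p < m (k + 1) → x l p = t k (τ l) p) → x ∈ G i k := by
  have step : ∀ k m : ℕ, ∃ m', m < m' ∧ ∃ t : (Fin k → Bool) → ℕ → Bool,
      ∀ i < k, ∀ τ : Fin (n i) → Fin k → Bool, Function.Injective τ →
        ∀ x : Fin (n i) → ℕ → Bool,
          (∀ l p, m ≤ p → p < m' → x l p = t (τ l) p) → x ∈ G i k := by
    intro k m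
    let E : (Σ i : Fin k, Fin (n i) ↪ (Fin k → Bool)) → Set ((Fin k → Bool) → ℕ → Bool) :=
      fun q => (fun y => y ∘ q.2) ⁻¹' G q.1 k
    have hEo : ∀ q, IsOpen (E q) := fun q => (hGo _ _).preimage
      (continuous_pi fun l => continuous_apply (q.2 l))
    have hEd : ∀ q, Dense (E q) := fun q =>
      (hGd _ _).preimage (isOpenMap_precomp_of_injective q.2.injective)
    obtain ⟨m', hm', t, ht⟩ := (dense_iInter_of_isOpen hEo hEd).exists_window
      (isOpen_iInter_of_finite hEo) m
    refine ⟨m', hm', t, fun i hi τ hτ x hx => ?_⟩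
    have h := mem_iInter.1 (ht (Function.extend τ x t) fun σ p h1 h2 => ?_) ⟨⟨i, hi⟩, ⟨τ, hτ⟩⟩
    · have h' : Function.extend τ x t ∘ τ ∈ G i k := h
      rwa [show Function.extend τ x t ∘ τ = x from funext (hτ.extend_apply x t)] at h'
    · by_cases hσ : ∃ l, τ l = σ
      · obtain ⟨l, rfl⟩ := hσ
        rw [hτ.extend_apply]
        exact hx l p h1 h2
      · rw [Function.extend_apply' _ _ _ hσ]
  choose next hnext t ht using step
  let m : ℕ → ℕ := fun k => Nat.rec 0 (fun k a => next k a) k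
  have hms : ∀ k, m (k + 1) = next k (m k) := fun k => rfl
  refine ⟨m, fun k => t k (m k), strictMono_nat_of_lt_succ fun k => ?_, rfl, fun k => ht k (m k)⟩
  rw [hms]
  exact hnext _ _

theorem eventually_injective_restrict {ι : Type*} [Finite ι] {b : ι → ℕ → Bool}
    (hb : Function.Injective b) :
    ∀ᶠ k in atTop, Function.Injective fun l => fun i : Fin k => b l i := by
  have h : ∀ l l' : ι, ∀ᶠ k in atTop,
      l ≠ l' → (fun i : Fin k => b l i) ≠ fun i : Fin k => b l' i := by
    intro l l'
    by_cases hll : l = l'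
    · exact Eventually.of_forall fun k h => absurd hll h
    · obtain ⟨p, hp⟩ := Function.ne_iff.1 (hb.ne hll)
      filter_upwards [eventually_gt_atTop p] with k hk _ heq
      exact hp (congrFun heq ⟨p, hk⟩)
  have h' := eventually_all.2 fun l => eventually_all.2 (h l)
  filter_upwards [h'] with k hk l l' hll
  by_contra hne
  exact hk l l' hne hll

/-- The combinatorial core: points of the Cantor space indexed by a set of size at most continuum,
the point with index `α` lying in a prescribed nonempty open set outside a prescribed meagre set,
such that tuples with distinct indices avoid countably many meagre relations. -/
theorem exists_free_family {I : Type*} (b : I → ℕ → Bool) (hb : Function.Injective b)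
    (V M : I → Set (ℕ → Bool)) (hV : ∀ α, IsOpen (V α)) (hVne : ∀ α, (V α).Nonempty)
    (hM : ∀ α, IsMeagre (M α)) (n : ℕ → ℕ) (R : ∀ i : ℕ, Set (Fin (n i) → ℕ → Bool))
    (hR : ∀ i, IsMeagre (R i)) :
    ∃ x : I → ℕ → Bool, (∀ α, x α ∈ V α \ M α) ∧
      ∀ i, ∀ a : Fin (n i) → I, Function.Injective a → x ∘ a ∉ R i := by
  classical
  choose G hGa hGo hGd hGR using fun i => (hR i).exists_antitone_dense_open
  obtain ⟨m, t, hm, hm0, ht⟩ := exists_generic_labels n G hGo hGd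
  obtain ⟨K, hK⟩ := hm.exists_blockIndex hm0
  have hU : (hyperfilter ℕ : Filter ℕ) ≤ cofinite := hyperfilter_le_cofinite
  choose Z y hZ hy using fun α => exists_small_modification hm hK hU (hV α) (hVne α) (hM α)
  -- on a block outside `Z α` the point follows the label of the branch `b α`
  let x : I → ℕ → Bool := fun α p =>
    if K p ∈ Z α then y α p else t (K p) (fun i => b α i) p
  refine ⟨x, fun α => hy α (x α) fun p hp => if_pos hp, fun i a ha => hGR i _ fun j => ?_⟩
  have h1 : ∀ᶠ k in (hyperfilter ℕ : Filter ℕ), ∀ l, k ∉ Z (a l) :=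
    eventually_all.2 fun l => Ultrafilter.compl_mem_iff_notMem.2 (hZ (a l))
  have h2 := (eventually_injective_restrict (hb.comp ha)).filter_mono
    (hU.trans_eq Nat.cofinite_eq_atTop)
  have h3 := (eventually_ge_atTop (max j (i + 1))).filter_mono
    (hU.trans_eq Nat.cofinite_eq_atTop)
  obtain ⟨k, hk1, hk2, hk3⟩ := (h1.and (h2.and h3)).exists
  refine ⟨k, by omega, ht k i (by omega) _ hk2 _ fun l p hp1 hp2 => ?_⟩
  have hKp : K p = k := by
    have e1 := (hK _ _).1 hp1
    have e2 : ¬ (k + 1 ≤ K p) := fun h => absurd ((hK _ _).2 h) (not_le.2 hp2)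
    omega
  subst hKp
  exact if_neg (hk1 l)

/-! ### Coding a Polish space by the Cantor space -/

/-- A weak form of continuous open surjection: a map which is continuous on a residual set `D`, for
which nonempty open sets have somewhere dense images (of their trace on `D`) and the image of `D` is
dense. -/
structure IsCategoryCoding {Y X : Type*} [TopologicalSpace Y] [TopologicalSpace X] (g : Y → X)
    (D : Set Y) : Prop where
  residual : D ∈ residual Y
  continuousOn : ContinuousOn g D
  somewhereDense : ∀ O : Set Y, IsOpen O → O.Nonempty →
    ∃ W : Set X, IsOpen W ∧ W.Nonempty ∧ W ⊆ closure (g '' (O ∩ D))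
  denseImage : Dense (g '' D)

/-- Meagre subsets of finite powers pull back to meagre sets: the preimage of a dense open set meets
every box, because the images of the sides of the box are dense in some open box. -/
theorem IsCategoryCoding.isMeagre_preimage {Y X : Type*} [TopologicalSpace Y] [TopologicalSpace X]
    {g : Y → X} {D : Set Y} (hg : IsCategoryCoding g D) {ι : Type*} [Finite ι]
    [BaireSpace (ι → X)] {R : Set (ι → X)} (hR : IsMeagre R) :
    IsMeagre ((fun y : ι → Y => g ∘ y) ⁻¹' R) := by
  have := Fintype.ofFinite ι
  obtain ⟨G, -, hGo, hGd, hGR⟩ := hR.exists_antitone_dense_open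
  let E : Set (ι → Y) := univ.pi fun _ => D
  have hE : E ∈ _root_.residual (ι → Y) := by
    have : E = ⋂ i : ι, (fun y : ι → Y => y i) ⁻¹' D := by ext y; simp [E]
    rw [this, countable_iInter_mem]
    intro i
    have h : IsMeagre ((fun y : ι → Y => y i) ⁻¹' Dᶜ) :=
      IsMeagre.preimage_of_isOpenMap (continuous_apply i) (isOpenMap_eval i)
        (by rw [IsMeagre, compl_compl]; exact hg.residual)
    rwa [IsMeagre, preimage_compl, compl_compl] at h
  have hcont : ContinuousOn (fun y : ι → Y => g ∘ y) E := by
    refine continuousOn_pi.2 fun i => hg.continuousOn.comp (continuous_apply i).continuousOn ?_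
    exact fun y hy => hy i (mem_univ i)
  have key : ∀ k, (fun y : ι → Y => g ∘ y) ⁻¹' G k ∈ _root_.residual (ι → Y) := by
    intro k
    obtain ⟨O, hO, hOE⟩ := continuousOn_iff'.1 hcont (G k) (hGo k)
    have hOd : Dense O := by
      refine dense_iff_inter_open.2 fun Q hQ ⟨q, hq⟩ => ?_
      obtain ⟨B, hB, hBQ⟩ := isOpen_pi_iff'.1 hQ q hq
      choose W hWo hWne hW using fun i => hg.somewhereDense (B i) (hB i).1 ⟨q i, (hB i).2⟩
      have hWpi : IsOpen (univ.pi W) := isOpen_set_pi finite_univ fun i _ => hWo i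
      have hWG : (univ.pi W ∩ G k).Nonempty :=
        (hGd k).inter_open_nonempty _ hWpi (univ_pi_nonempty_iff.2 hWne)
      obtain ⟨w, hw, hwG⟩ := hWG
      have hwc : w ∈ closure (univ.pi fun i => g '' (B i ∩ D)) := by
        rw [closure_pi_set]
        exact fun i hi => hW i (hw i hi)
      obtain ⟨v, hvG, hv⟩ := mem_closure_iff.1 hwc (G k) (hGo k) hwG
      choose y hy hyv using fun i => hv i (mem_univ i)
      have hgy : g ∘ y = v := funext hyv
      have hyE : y ∈ E := fun i _ => (hy i).2
      have hyO : y ∈ O ∩ E := by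
        rw [← hOE]
        exact ⟨by rw [mem_preimage, hgy]; exact hvG, hyE⟩
      exact ⟨y, hBQ fun i _ => (hy i).1, hyO.1⟩
    refine mem_of_superset (inter_mem (residual_of_dense_open hO hOd) hE) ?_
    rw [← hOE]
    exact inter_subset_left
  rw [IsMeagre]
  refine mem_of_superset (countable_iInter_mem.2 key) fun y hy hyR => ?_
  exact hGR _ (fun j => ⟨j, le_rfl, mem_iInter.1 hy j⟩) hyR

open Classical in
/-- A decreasing sequence of open sets read off from `y` in the Cantor space: at a position `n` with
`y n = true` one shrinks to the `n`-th set `B n`, provided this is a subset. -/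
noncomputable def shrinkingSets {X : Type*} (B : ℕ → Set X) (y : ℕ → Bool) : ℕ → Set X
  | 0 => univ
  | n + 1 => if y n = true ∧ B n ⊆ shrinkingSets B y n then B n else shrinkingSets B y n

section ShrinkingSets

variable {X : Type*} {B : ℕ → Set X}

theorem shrinkingSets_congr {y y' : ℕ → Bool} {n : ℕ} (h : ∀ p < n, y p = y' p) :
    shrinkingSets B y n = shrinkingSets B y' n := by
  induction n with
  | zero => rfl
  | succ n ih => rw [shrinkingSets, shrinkingSets, ih fun p hp => h p (by omega), h n (by omega)]

theorem shrinkingSets_antitone (y : ℕ → Bool) : Antitone (shrinkingSets B y) := by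
  refine antitone_nat_of_succ_le fun n => ?_
  rw [shrinkingSets]
  split_ifs with h
  · exact h.2
  · exact le_rfl

theorem isOpen_shrinkingSets [TopologicalSpace X] (hB : ∀ n, IsOpen (B n)) (y : ℕ → Bool) (n : ℕ) :
    IsOpen (shrinkingSets B y n) := by
  induction n with
  | zero => exact isOpen_univ
  | succ n ih =>
    rw [shrinkingSets]
    split_ifs
    · exact hB n
    · exact ih

theorem nonempty_shrinkingSets [Nonempty X] (hB : ∀ n, (B n).Nonempty) (y : ℕ → Bool) (n : ℕ) :
    (shrinkingSets B y n).Nonempty := by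
  induction n with
  | zero => exact univ_nonempty
  | succ n ih =>
    rw [shrinkingSets]
    split_ifs
    · exact hB n
    · exact ih

/-- One can change `y` from `n₀` on so as to shrink next to `B n`: put `false` at the positions
between `n₀` and `n`, and `true` at `n`. -/
theorem exists_extension_shrinkingSets_eq (y : ℕ → Bool) {n₀ n : ℕ} (hn : n₀ ≤ n)
    (hB : B n ⊆ shrinkingSets B y n₀) :
    ∃ y' : ℕ → Bool, (∀ p < n₀, y' p = y p) ∧ shrinkingSets B y' (n + 1) = B n := by
  classical
  let y' : ℕ → Bool := fun p => if p < n₀ then y p else decide (p = n)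
  have h0 : ∀ p < n₀, y' p = y p := fun p hp => if_pos hp
  have h1 : ∀ k, n₀ ≤ k → k ≤ n → shrinkingSets B y' k = shrinkingSets B y n₀ := by
    intro k hk
    induction k, hk using Nat.le_induction with
    | base => exact fun _ => shrinkingSets_congr h0
    | succ k hk ih =>
      intro hkn
      have : y' k = false := by
        simp only [y', if_neg (not_lt.2 hk)]
        exact decide_eq_false (by omega)
      rw [shrinkingSets, if_neg (by simp [this]), ih (by omega)]
  have h2 : y' n = true := by simp [y', not_lt.2 hn]
  exact ⟨y', h0, by rw [shrinkingSets, if_pos ⟨h2, by rwa [h1 n hn le_rfl]⟩]⟩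

end ShrinkingSets

theorem isOpen_prefix (y : ℕ → Bool) (n : ℕ) : IsOpen {z : ℕ → Bool | ∀ p < n, z p = y p} := by
  have : {z : ℕ → Bool | ∀ p < n, z p = y p} = ⋂ p ∈ Iio n, (fun z : ℕ → Bool => z p) ⁻¹' {y p} := by
    ext z; simp
  rw [this]
  exact (finite_Iio n).isOpen_biInter fun p _ => (isOpen_discrete _).preimage (continuous_apply p)

/-- A sequence of nonempty open sets in which arbitrarily small subsets of any nonempty open set
occur at arbitrarily late positions. The ball of radius `1 / (j + 1)` around the `i`-th point of a
dense sequence has position `Nat.pair i j ≥ j`, so small balls automatically come late. -/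
theorem exists_seq_small_balls (X : Type*) [MetricSpace X] [TopologicalSpace.SeparableSpace X]
    [Nonempty X] :
    ∃ B : ℕ → Set X, (∀ n, IsOpen (B n)) ∧ (∀ n, (B n).Nonempty) ∧
      ∀ (V : Set X) (_ : IsOpen V) (_ : V.Nonempty) (ε : ℝ) (_ : 0 < ε) (N : ℕ),
        ∃ n, N ≤ n ∧ B n ⊆ V ∧ ∃ c, B n ⊆ Metric.ball c ε := by
  refine ⟨fun n => Metric.ball (TopologicalSpace.denseSeq X n.unpair.1) (1 / (n.unpair.2 + 1)),
    fun n => Metric.isOpen_ball, fun n => Metric.nonempty_ball.2 (by positivity), ?_⟩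
  rintro V hV ⟨v, hv⟩ ε hε N
  obtain ⟨r, hr, hrV⟩ := Metric.isOpen_iff.1 hV v hv
  obtain ⟨j₀, hj₀⟩ := exists_nat_one_div_lt (show 0 < min ε (r / 2) by positivity)
  let j := max j₀ N
  have hj : 1 / ((j : ℝ) + 1) < min ε (r / 2) := by
    refine lt_of_le_of_lt ?_ hj₀
    have : (j₀ : ℝ) ≤ j := by exact_mod_cast le_max_left _ _
    gcongr
  obtain ⟨i, hi⟩ := (TopologicalSpace.denseRange_denseSeq X).exists_dist_lt v
    (show 0 < r / 2 by positivity)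
  refine ⟨Nat.pair i j, (le_max_right j₀ N).trans (Nat.right_le_pair i j), ?_,
    TopologicalSpace.denseSeq X i, ?_⟩
  · refine Subset.trans (fun x hx => ?_) hrV
    simp only [Nat.unpair_pair, Metric.mem_ball] at hx ⊢
    have := dist_triangle x (TopologicalSpace.denseSeq X i) v
    rw [dist_comm v] at hi
    linarith [min_le_right ε (r / 2)]
  · simp only [Nat.unpair_pair]
    exact Metric.ball_subset_ball (hj.le.trans (min_le_left _ _))

/-- Every nonempty Polish space is coded by the Cantor space: to almost every `y` corresponds the
point in the intersection of the shrinking sets of `y`. -/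
theorem exists_isCategoryCoding (X : Type*) [TopologicalSpace X] [PolishSpace X] [Nonempty X] :
    ∃ (g : (ℕ → Bool) → X) (D : Set (ℕ → Bool)), IsCategoryCoding g D := by
  let := TopologicalSpace.upgradeIsCompletelyMetrizable X
  obtain ⟨B, hBo, hBne, hB⟩ := exists_seq_small_balls X
  let L := shrinkingSets B
  let D' : ℕ → Set (ℕ → Bool) := fun j => {y | ∃ n c, L y n ⊆ Metric.ball c (1 / ((j : ℝ) + 1))}
  let D : Set (ℕ → Bool) := ⋂ j, D' j
  have hD'o : ∀ j, IsOpen (D' j) := by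
    intro j
    refine isOpen_iff_mem_nhds.2 ?_
    rintro y ⟨n, c, hc⟩
    refine mem_of_superset ((isOpen_prefix y n).mem_nhds fun p _ => rfl) fun z hz => ?_
    exact ⟨n, c, by rwa [show L z n = L y n from shrinkingSets_congr hz]⟩
  have hD'd : ∀ j, Dense (D' j) := by
    intro j
    refine dense_iff_inter_open.2 fun O hO ⟨y, hy⟩ => ?_
    obtain ⟨n₀, hn₀⟩ := exists_prefix_subset_of_isOpen_cantor hO hy
    obtain ⟨n, hn, hnV, c, hc⟩ := hB (L y n₀) (isOpen_shrinkingSets hBo y n₀)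
      (nonempty_shrinkingSets hBne y n₀) (1 / ((j : ℝ) + 1)) (by positivity) n₀
    obtain ⟨y', hy', hy'n⟩ := exists_extension_shrinkingSets_eq y hn hnV
    exact ⟨y', hn₀ y' hy', n + 1, c, by rwa [show L y' (n + 1) = B n from hy'n]⟩
  have hDd : Dense D := dense_iInter_of_isOpen hD'o hD'd
  have hsmall : ∀ y ∈ D, ∀ ε > 0, ∃ n c, L y n ⊆ Metric.ball c ε := by
    intro y hy ε hε
    obtain ⟨j, hj⟩ := exists_nat_one_div_lt hε
    obtain ⟨n, c, hc⟩ := mem_iInter.1 hy j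
    exact ⟨n, c, hc.trans (Metric.ball_subset_ball hj.le)⟩
  have hlim : ∀ y, ∃ x, y ∈ D → ∀ n, x ∈ closure (L y n) := by
    intro y
    by_cases hy : y ∈ D
    swap
    · exact ⟨Classical.arbitrary X, fun h => absurd h hy⟩
    choose s hs using nonempty_shrinkingSets hBne y
    have hcau : CauchySeq s := by
      refine Metric.cauchySeq_iff'.2 fun ε hε => ?_
      obtain ⟨n, c, hc⟩ := hsmall y hy (ε / 2) (by positivity)
      refine ⟨n, fun k hk => ?_⟩
      have h1 := Metric.mem_ball.1 (hc (shrinkingSets_antitone y hk (hs k)))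
      have h2 := Metric.mem_ball'.1 (hc (hs n))
      linarith [dist_triangle (s k) c (s n)]
    obtain ⟨x, hx⟩ := cauchySeq_tendsto_of_complete hcau
    refine ⟨x, fun _ n => mem_closure_of_tendsto hx ?_⟩
    filter_upwards [eventually_ge_atTop n] with k hk
    exact shrinkingSets_antitone y hk (hs k)
  choose g hg using hlim
  -- steer `y` into a ball well inside `V` first, then move to a nearby point of `D`
  have hdense : ∀ y n₀, L y n₀ ⊆ closure (g '' ({z | ∀ p < n₀, z p = y p} ∩ D)) := by
    intro y n₀ x hx
    refine mem_closure_iff.2 fun V hV hxV => ?_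
    have hVL : V ∩ L y n₀ ∈ 𝓝 x :=
      inter_mem (hV.mem_nhds hxV) ((isOpen_shrinkingSets hBo y n₀).mem_nhds hx)
    obtain ⟨C, hC, hCc, hCV⟩ := exists_mem_nhds_isClosed_subset hVL
    obtain ⟨n, hn, hnV, -⟩ := hB (interior C) isOpen_interior
      ⟨x, mem_interior_iff_mem_nhds.2 hC⟩ 1 one_pos n₀
    obtain ⟨y', hy', hy'n⟩ := exists_extension_shrinkingSets_eq y hn
      ((hnV.trans interior_subset).trans (hCV.trans inter_subset_right))
    obtain ⟨z, hz, hzD⟩ := hDd.inter_open_nonempty _ (isOpen_prefix y' (n + 1))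
      ⟨y', fun p _ => rfl⟩
    have hzL : L z (n + 1) = B n := (shrinkingSets_congr hz).trans hy'n
    have hgz := hg z hzD (n + 1)
    rw [hzL] at hgz
    refine ⟨g z, (hCV (closure_minimal (hnV.trans interior_subset) hCc hgz)).1, z, ⟨?_, hzD⟩, rfl⟩
    exact fun p hp => (hz p (by omega)).trans (hy' p hp)
  refine ⟨g, D, ?_, ?_, ?_, ?_⟩
  · exact countable_iInter_mem.2 fun j => residual_of_dense_open (hD'o j) (hD'd j)
  · intro y hy
    refine Metric.tendsto_nhds.2 fun ε hε => ?_
    obtain ⟨n, c, hc⟩ := hsmall y hy (ε / 3) (by positivity)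
    have hc' : closure (L y n) ⊆ Metric.closedBall c (ε / 3) :=
      closure_minimal (hc.trans Metric.ball_subset_closedBall) Metric.isClosed_closedBall
    filter_upwards [inter_mem_nhdsWithin D ((isOpen_prefix y n).mem_nhds fun p _ => rfl)]
      with z hz
    have h1 := hg z hz.1 n
    rw [show L z n = L y n from shrinkingSets_congr hz.2] at h1
    have h2 := Metric.mem_closedBall.1 (hc' h1)
    have h3 := Metric.mem_closedBall'.1 (hc' (hg y hy n))
    linarith [dist_triangle (g z) c (g y)]
  · rintro O hO ⟨y, hy⟩
    obtain ⟨n, hn⟩ := exists_prefix_subset_of_isOpen_cantor hO hy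
    refine ⟨L y n, isOpen_shrinkingSets hBo y n, nonempty_shrinkingSets hBne y n,
      (hdense y n).trans (closure_mono (image_mono (inter_subset_inter_left D ?_)))⟩
    exact hn
  · intro x
    have h := hdense (fun _ => false) 0 (mem_univ x)
    exact closure_mono (image_mono inter_subset_right) h

/-! ### The cofinality of the meagre ideal -/

theorem exists_nat_basis (Y : Type*) [TopologicalSpace Y] [SecondCountableTopology Y]
    [Nonempty Y] :
    ∃ B : ℕ → Set Y, TopologicalSpace.IsTopologicalBasis (range B) ∧ ∀ n, (B n).Nonempty := by
  obtain ⟨b, hbc, hbe, hb⟩ := TopologicalSpace.exists_countable_basis Y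
  obtain ⟨s, hs, -⟩ := hb.exists_subset_of_mem_open (mem_univ (Classical.arbitrary Y)) isOpen_univ
  obtain ⟨B, rfl⟩ := hbc.exists_eq_range ⟨s, hs⟩
  exact ⟨B, hb, fun n => nonempty_iff_ne_empty.2 fun h => hbe ⟨n, h⟩⟩

theorem isMeagre_singleton_cantor (y : ℕ → Bool) : IsMeagre ({y} : Set (ℕ → Bool)) := by
  refine residual_of_dense_open isOpen_compl_singleton
    (dense_iff_inter_open.2 fun O hO ⟨z, hz⟩ => ?_)
  obtain ⟨n, hn⟩ := exists_prefix_subset_of_isOpen_cantor hO hz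
  -- the value at `n` is free within `O` and can be chosen different from `y n`
  refine ⟨Function.update z n (!y n), hn _ fun p hp => Function.update_of_ne hp.ne _ _, ?_⟩
  intro h
  have := congrFun (mem_singleton_iff.1 h) n
  simp at this

theorem exists_cofinal_card_eq_cofMeager :
    ∃ M : Set (Set (ℕ → Bool)), (∀ A ∈ M, IsMeagre A) ∧
      (∀ N : Set (ℕ → Bool), IsMeagre N → ∃ A ∈ M, N ⊆ A) ∧ #M = cofMeager :=
  csInf_mem (s := {c : Cardinal.{0} | ∃ M : Set (Set (ℕ → Bool)), (∀ A ∈ M, IsMeagre A) ∧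
    (∀ N : Set (ℕ → Bool), IsMeagre N → ∃ A ∈ M, N ⊆ A) ∧ #M = c})
    ⟨_, {A | IsMeagre A}, fun _ h => h, fun N hN => ⟨N, hN, Subset.rfl⟩, rfl⟩

/-- A countable family cannot be cofinal: its union is meagre but would contain every singleton. -/
theorem aleph0_le_cofMeager : ℵ₀ ≤ cofMeager := by
  obtain ⟨M, hM, hcof, hcard⟩ := exists_cofinal_card_eq_cofMeager
  by_contra! h
  have hMc : M.Countable := le_aleph0_iff_set_countable.1 (hcard ▸ h.le)
  have hU : IsMeagre (⋃ A ∈ M, A) := isMeagre_biUnion hMc hM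
  refine not_isMeagre_of_isOpen isOpen_univ univ_nonempty (hU.mono fun y _ => ?_)
  obtain ⟨A, hA, hy⟩ := hcof {y} (isMeagre_singleton_cantor y)
  exact mem_biUnion hA (hy rfl)

/-- The meagre `Fσ` sets form a cofinal family, and each is coded by a sequence of sets of indices
of basic open sets. -/
theorem cofMeager_le_continuum : cofMeager ≤ 𝔠 := by
  obtain ⟨B, hB, -⟩ := exists_nat_basis (ℕ → Bool)
  let A : (ℕ → Set ℕ) → Set (ℕ → Bool) := fun f => ⋃ j, (⋃ n ∈ f j, B n)ᶜ
  let M : Set (Set (ℕ → Bool)) := {S ∈ range A | IsMeagre S}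
  have hM : #M ≤ 𝔠 := by
    calc #M ≤ #(range A) := mk_le_mk_of_subset (sep_subset _ _)
      _ ≤ #(ℕ → Set ℕ) := mk_range_le
      _ = 𝔠 := by simp
  refine le_trans (csInf_le' ⟨M, fun S hS => hS.2, fun N hN => ?_, rfl⟩) hM
  obtain ⟨G, -, hGo, hGd, hGN⟩ := hN.exists_antitone_dense_open
  have hG : ∀ j, G j = ⋃ n ∈ {n | B n ⊆ G j}, B n := by
    intro j
    refine Subset.antisymm (fun y hy => ?_) (iUnion₂_subset fun n hn => hn)
    obtain ⟨_, ⟨n, rfl⟩, hyn, hn⟩ := hB.exists_subset_of_mem_open hy (hGo j)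
    exact mem_biUnion (show n ∈ {n | B n ⊆ G j} from hn) hyn
  have hA : A (fun j => {n | B n ⊆ G j}) = ⋃ j, (G j)ᶜ :=
    iUnion_congr fun j => by rw [← hG j]
  refine ⟨_, ⟨⟨fun j => {n | B n ⊆ G j}, rfl⟩, ?_⟩, ?_⟩
  · rw [hA]
    refine isMeagre_iUnion fun j => ?_
    rw [IsMeagre, compl_compl]
    exact residual_of_dense_open (hGo j) (hGd j)
  · rw [hA]
    intro y hy
    by_contra h
    simp only [mem_iUnion, mem_compl_iff, not_exists, not_not] at h
    exact hGN y (fun j => ⟨j, le_rfl, h j⟩) hy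

/-! ### Dense Baire subspaces -/

/-- A subset that is nonmeagre in every nonempty open set is a Baire space. -/
theorem baireSpace_of_forall_inter_not_subset {X : Type*} [TopologicalSpace X] {F : Set X}
    (hF : ∀ V M : Set X, IsOpen V → V.Nonempty → IsMeagre M → ((F ∩ V) \ M).Nonempty) :
    BaireSpace F := by
  refine ⟨fun f hfo hfd => ?_⟩
  choose O hO hOf using fun n => isOpen_induced_iff.1 (hfo n)
  have hFd : Dense F := dense_iff_inter_open.2 fun V hV hne =>
    let ⟨x, hx⟩ := hF V ∅ hV hne IsMeagre.empty
    ⟨x, hx.1.2, hx.1.1⟩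
  have hOd : ∀ n, Dense (O n) := by
    intro n
    have h := hFd.denseRange_val.dense_image continuous_subtype_val (hfd n)
    refine h.mono ?_
    rintro _ ⟨x, hx, rfl⟩
    rw [← hOf n] at hx
    exact hx
  have hM : IsMeagre (⋃ n, (O n)ᶜ) := isMeagre_iUnion fun n => by
    rw [IsMeagre, compl_compl]
    exact residual_of_dense_open (hO n) (hOd n)
  refine dense_iff_inter_open.2 fun Q hQ ⟨q, hq⟩ => ?_
  obtain ⟨V, hV, rfl⟩ := isOpen_induced_iff.1 hQ
  obtain ⟨x, ⟨hxF, hxV⟩, hxM⟩ := hF V _ hV ⟨q, hq⟩ hM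
  refine ⟨⟨x, hxF⟩, hxV, mem_iInter.2 fun n => ?_⟩
  rw [← hOf n]
  by_contra h
  exact hxM (mem_iUnion.2 ⟨n, h⟩)

theorem isMeagre_diagonal (X : Type*) [TopologicalSpace X] [T2Space X] [PerfectSpace X] :
    IsMeagre {x : Fin 2 → X | x 0 = x 1} := by
  refine residual_of_dense_open
    (isClosed_eq (continuous_apply 0) (continuous_apply 1)).isOpen_compl
    (dense_iff_inter_open.2 fun O hO ⟨x, hx⟩ => ?_)
  -- moving the first coordinate a little leaves the diagonal
  have hc : Continuous fun z : X => Function.update x 0 z := continuous_const.update 0 continuous_id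
  have hO' : (fun z : X => Function.update x 0 z) ⁻¹' O ∈ 𝓝[≠] (x 0) :=
    mem_nhdsWithin_of_mem_nhds ((hO.preimage hc).mem_nhds (by simpa using hx))
  by_cases h01 : x 0 = x 1
  · obtain ⟨z, hz, hz0⟩ := Filter.nonempty_of_mem (inter_mem hO' self_mem_nhdsWithin)
    refine ⟨_, hz, fun h => hz0 ?_⟩
    have h' : z = x 1 := by simpa using h
    exact h'.trans h01.symm
  · exact ⟨x, hx, h01⟩

/-! ### Free dense Baire sets of prescribed size -/

/-- The points of a free family in the Cantor space, carried over to `X` along a category coding;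
the index set enumerates the pairs of a basic open set and a member of a cofinal family of meagre
sets, and the diagonal, added to the relations, keeps the points distinct. -/
theorem exists_free_dense_baire_card_eq (X : Type u) [TopologicalSpace X] [PolishSpace X]
    [Nonempty X] [PerfectSpace X] (𝓡 : Set (FinitaryRel X)) (h𝓡 : 𝓡.Countable)
    (hmeager : ∀ R ∈ 𝓡, R.IsMeager) (κ : Cardinal.{u}) (hκ : Cardinal.lift.{u} cofMeager ≤ κ)
    (hκc : κ ≤ Cardinal.continuum.{u}) :
    ∃ F : Set X, Dense F ∧ BaireSpace F ∧ (∀ R ∈ 𝓡, R.IsFree F) ∧ #F = κ := by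
  obtain ⟨g, D, hg⟩ := exists_isCategoryCoding X
  let Δ : FinitaryRel X := ⟨2, one_le_two, {x | x 0 = x 1}⟩
  obtain ⟨S, hS⟩ := (h𝓡.insert Δ).exists_eq_range (insert_nonempty _ _)
  have hSm : ∀ i, IsMeagre (S i).carrier := by
    intro i
    have : S i ∈ insert Δ 𝓡 := hS ▸ mem_range_self i
    rcases this with h | h
    · rw [h]
      exact isMeagre_diagonal X
    · exact hmeager _ h
  obtain ⟨𝓜, h𝓜, hcof, hcard⟩ := exists_cofinal_card_eq_cofMeager
  have h𝓜ne : Nonempty 𝓜 :=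
    let ⟨A, hA, _⟩ := hcof ∅ IsMeagre.empty
    ⟨⟨A, hA⟩⟩
  obtain ⟨B, hB, hBne⟩ := exists_nat_basis (ℕ → Bool)
  have hsize : Cardinal.lift.{u} #(ℕ × 𝓜) ≤ #κ.out := by
    rw [mk_out, mk_prod, hcard, lift_id, lift_id, mk_nat,
      aleph0_mul_eq aleph0_le_cofMeager]
    exact hκ
  obtain ⟨e⟩ : Nonempty ((ℕ × 𝓜) ↪ κ.out) := lift_mk_le'.1 (by simpa using hsize)
  have hφ : Function.Surjective (Function.invFun e) := Function.invFun_surjective e.injective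
  let φ := Function.invFun e
  obtain ⟨b⟩ : Nonempty (κ.out ↪ (ℕ → Bool)) := by
    refine lift_mk_le'.1 ?_
    simpa using hκc
  obtain ⟨x, hx, hxfree⟩ := exists_free_family b b.injective
    (fun α => B (φ α).1) (fun α => (φ α).2.1)
    (fun α => hB.isOpen (mem_range_self _)) (fun α => hBne _) (fun α => h𝓜 _ (φ α).2.2)
    (fun i => (S i).arity) (fun i => (fun y => g ∘ y) ⁻¹' (S i).carrier)
    (fun i => hg.isMeagre_preimage (hSm i))
  have hinj : Function.Injective (g ∘ x) := by
    intro α β hαβ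
    by_contra hne
    obtain ⟨i, hi⟩ : Δ ∈ range S := hS ▸ mem_insert _ _
    -- stated for a variable `T` so that the arity of `S i` can be replaced by `2`
    have key : ∀ T : FinitaryRel X, (∀ a : Fin T.arity → κ.out, Function.Injective a →
        g ∘ x ∘ a ∉ T.carrier) → T = Δ → False := by
      rintro T hT rfl
      refine hT ![α, β] ?_ hαβ
      intro p q hpq
      fin_cases p <;> fin_cases q <;> simp_all
    exact key (S i) (hxfree i) hi
  have hnm : ∀ V M : Set X, IsOpen V → V.Nonempty → IsMeagre M →
      ((range (g ∘ x) ∩ V) \ M).Nonempty := by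
    intro V M hV hVne hM
    obtain ⟨O, hO, hOD⟩ := continuousOn_iff'.1 hg.continuousOn V hV
    obtain ⟨_, hyV, y, hyD, rfl⟩ := hg.denseImage.inter_open_nonempty V hV hVne
    have hyO : y ∈ O ∩ D := hOD ▸ ⟨hyV, hyD⟩
    obtain ⟨_, ⟨n, rfl⟩, -, hn⟩ := hB.exists_subset_of_mem_open hyO.1 hO
    have hgM : IsMeagre (g ⁻¹' M) := by
      have h1 : IsMeagre ((fun z : Unit → X => z ()) ⁻¹' M) :=
        hM.preimage_of_isOpenMap (continuous_apply ()) (isOpenMap_eval ())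
      have h2 := hg.isMeagre_preimage h1
      exact h2.preimage_of_isOpenMap (f := fun (y : ℕ → Bool) (_ : Unit) => y)
        (Homeomorph.funUnique Unit (ℕ → Bool)).symm.continuous
        (Homeomorph.funUnique Unit (ℕ → Bool)).symm.isOpenMap
    have hDm : IsMeagre Dᶜ := by rw [IsMeagre, compl_compl]; exact hg.residual
    obtain ⟨A, hA, hMA⟩ := hcof _ (hgM.union hDm)
    obtain ⟨α, hα⟩ := hφ (n, ⟨A, hA⟩)
    have hα' : φ α = (n, ⟨A, hA⟩) := hα
    have hxα := hx α
    simp only [hα'] at hxα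
    have hxD : x α ∈ D := by
      by_contra h
      exact hxα.2 (hMA (Or.inr h))
    have hxV : x α ∈ g ⁻¹' V ∩ D := hOD ▸ ⟨hn hxα.1, hxD⟩
    exact ⟨g (x α), ⟨⟨α, rfl⟩, hxV.1⟩, fun h => hxα.2 (hMA (Or.inl h))⟩
  refine ⟨range (g ∘ x), ?_, baireSpace_of_forall_inter_not_subset hnm, ?_, ?_⟩
  · refine dense_iff_inter_open.2 fun V hV hne => ?_
    obtain ⟨z, hz⟩ := hnm V ∅ hV hne IsMeagre.empty
    exact ⟨z, hz.1.2, hz.1.1⟩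
  · intro R hR z hz hzF
    obtain ⟨i, rfl⟩ : R ∈ range S := hS ▸ mem_insert_of_mem _ hR
    choose a ha using hzF
    have ha' : g ∘ x ∘ a = z := funext ha
    have hainj : Function.Injective a := by
      refine Function.Injective.of_comp (f := g ∘ x) ?_
      rw [Function.comp_assoc, ha']
      exact hz
    rw [← ha']
    exact hxfree i a hainj
  · rw [mk_range_eq _ hinj, mk_out]

theorem theorem4p2 (X : Type u) [TopologicalSpace X] [PolishSpace X]
    [Nonempty X] [PerfectSpace X]
    (𝓡 : Set (FinitaryRel X)) (h𝓡 : 𝓡.Countable) (hmeager : ∀ R ∈ 𝓡, R.IsMeager) :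
    (∃ F : Set X, Dense F ∧ BaireSpace F ∧ ∀ R ∈ 𝓡, R.IsFree F) ∧
    ∀ κ : Cardinal.{u}, Cardinal.lift.{u} cofMeager ≤ κ → κ ≤ Cardinal.continuum.{u} →
      ∃ F : Set X, Dense F ∧ BaireSpace F ∧ (∀ R ∈ 𝓡, R.IsFree F) ∧ #F = κ := by
  have hmain := exists_free_dense_baire_card_eq X 𝓡 h𝓡 hmeager
  refine ⟨?_, hmain⟩
  have hc : Cardinal.lift.{u} cofMeager ≤ Cardinal.continuum.{u} := by
    rw [← lift_continuum.{u, 0}]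
    exact lift_le.2 cofMeager_le_continuum
  obtain ⟨F, hFd, hFB, hFfree, -⟩ := hmain _ hc le_rfl
  exact ⟨F, hFd, hFB, hFfree⟩
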